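/- **Setting.** A graph problem is $G=(N,A,B)$ with $N$ nodes, a weighted adjacency matrix $A=(a_{ij})\in\mathbb{R}^{N\times N}$ and local external inputs $B=(b_i)\in\mathbb{R}^N$; in addition each node $i$ may carry a vector $x_i\in\mathbb{R}^p$ of descriptors (node type, location, …), where $p\ge 0$ is fixed ($p=0$: no descriptor). The set of problems is topologized as the disjoint union over $N$ of the Euclidean spaces of data $(A,B,(x_i)_i)$. Two distinct nodes $i,j$ are neighbours, $j\in\mathcal N(i)$, if $a_{ij}\ne0$ or $a_{ji}\neq 0$. The loss is $$\mathcal L_{\rm res}(U,G)=\frac1N\sum_{i}\Big(-b_i+\sum_j a_{ij}u_j\Big)^2,\qquad U\in\mathbb R^N .$$ Let $\mathcal D$ be a Borel probability distribution on the set of problems such that * its support $\operatorname{supp}\mathcal D$ is compact; * every $G\in\operatorname{supp}\mathcal D$ is connected for the neighbourhood relation above (one connected component, $N\ge1$); * in every $G\in\operatorname{supp}\mathcal D$ the nodes are identifiable: $(b_i,x_i)\neq(b_j,x_j)$ for $i\ne j$; * for every $G\in\operatorname{supp}\mathcal D$ the minimizer $U^*_G=\operatorname{argmin}_U\mathcal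 L_{\rm res}(U,G)$ exists and is unique. **Implicit graph-NN.** For $d,m\ge0$, a graph-NN block $h=h_\theta$ is given by four ReLU multi-layer perceptrons $\Phi_\to,\Phi_\leftarrow,\Phi_\circlearrowleft$ (with values in $\mathbb R^m$) and $\Psi$ (with values in $\mathbb R^{1+d}$), of any depth and any widths and with affine output layer. It acts on latent states $H=(H_i)_{i\in[N]}$, $H_i\in\mathbb R^{1+d}$, by one step of message passing: $$h(H,G)_i=H_i+\Psi\big(H_i,b_i,x_i,\phi_{\to,i},\phi_{\leftarrow,i},\phi_{\circlearrowleft,i}\big),$$ $$\phi_{\to,i}=\sum_{j\in\mathcal N(i)}\Phi_\to(H_i,H_j,a_{ij}),\quad \phi_{\leftarrow,i}=\sum_{j\in\mathcal N(i)}\Phi_\leftarrow(H_i,H_j,a_{ji}),\quad \phi_{\circlearrowleft,i}=\Phi_\circlearrowleft(H_i,a_{ii}).$$ A state $U\in\mathbb R^N$ is regarded as the latent state $\big((u_i,0,\dots,0)\big)_{i\in[N]}$, and $\|\cdot\|$ denotes the Euclidean norm on $(\mathbb R^{1+d})^N$. **Corollary (Existence of an implicit graph-NN whose fixed point approximates $\varphi: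 G\mapsto U^*_G$).** For every $\varepsilon>0$ there exist $d,m$ and a single graph-NN block $h$ as above (the same for all problems) such that for every problem $G\in\operatorname{supp}\mathcal D$ the function $H\mapsto h(H,G)$ has a unique fixed point $H^*_G$ in $(\mathbb R^{1+d})^N$, and it satisfies $$\|H^*_G-U^*_G\|\le\varepsilon .$$ -/

import Mathlib

open MeasureTheory

/-- A graph problem `G = (N, A, B)` on `N` nodes: `A` is the weighted adjacency matrix, `B` the local
external input.  Every node `i` may in addition carry a vector `X i` of `p` real descriptors (node
type, location in space, ...); for `p = 0` this is the bare triple `(N, A, B)`. -/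
structure GraphProblem (p : ℕ) where
  N : ℕ
  A : Matrix (Fin N) (Fin N) ℝ
  B : Fin N → ℝ
  X : Fin N → Fin p → ℝ

namespace GraphProblem

variable {p : ℕ}

/-- The data of a problem, in the disjoint union over `N` of the Euclidean spaces of data. -/
def data (G : GraphProblem p) :
    Σ N : ℕ, Matrix (Fin N) (Fin N) ℝ × (Fin N → ℝ) × (Fin N → Fin p → ℝ) :=
  ⟨G.N, G.A, G.B, G.X⟩

/-- The set of problems is topologized as the disjoint union over `N` of Euclidean spaces. -/
instance : TopologicalSpace (GraphProblem p) :=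
  TopologicalSpace.induced data inferInstance

instance : MeasurableSpace (GraphProblem p) := borel _

instance : BorelSpace (GraphProblem p) := ⟨rfl⟩

/-- The mean square error of the residual, `MSE (A U - B)`. -/
noncomputable def residualLoss (G : GraphProblem p) (U : Fin G.N → ℝ) : ℝ :=
  (1 / (G.N : ℝ)) * ∑ i, (-G.B i + ∑ j, G.A i j * U j) ^ 2

/-- `U` belongs to `argmin_U residualLoss G U`. -/
def IsOptimal (G : GraphProblem p) (U : Fin G.N → ℝ) : Prop :=
  ∀ V : Fin G.N → ℝ, G.residualLoss U ≤ G.residualLoss V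

/-- The underlying undirected graph: two distinct nodes are neighbours when they interact in at
least one direction. -/
def graph (G : GraphProblem p) : SimpleGraph (Fin G.N) where
  Adj i j := i ≠ j ∧ (G.A i j ≠ 0 ∨ G.A j i ≠ 0)
  symm := ⟨fun _ _ h => ⟨h.1.symm, h.2.symm⟩⟩
  loopless := ⟨fun _ h => h.1 rfl⟩

/-- The nodes of `G` are identifiable: distinct nodes have distinct external inputs
(local input together with descriptors). -/
def Identifiable (G : GraphProblem p) : Prop :=
  ∀ i j : Fin G.N, i ≠ j → (G.B i, G.X i) ≠ (G.B j, G.X j)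

end GraphProblem

/-- Multi-layer perceptrons with inputs indexed by `ι` and outputs indexed by `κ`, any number of
hidden layers and any widths, given by their weights and biases. -/
inductive MLP (κ : Type) : Type → Type 1 where
  | output {ι : Type} (W : Matrix κ ι ℝ) (b : κ → ℝ) : MLP κ ι
  | hidden {ι : Type} (k : ℕ) (W : Matrix (Fin k) ι ℝ) (b : Fin k → ℝ) (rest : MLP κ (Fin k)) :
      MLP κ ι

/-- The function computed by a multi-layer perceptron: ReLU activation after each hidden layer,
affine output layer. -/
def MLP.eval {κ : Type} : {ι : Type} → [Fintype ι] → MLP κ ι → (ι → ℝ) → (κ → ℝ)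
  | _, _, .output W b, x => fun c => ∑ e, W c e * x e + b c
  | _, _, .hidden _ W b rest, x => rest.eval fun l => max 0 (∑ e, W l e * x e + b l)

/-- The parameters `θ` of one message-passing block: three message networks (outgoing, incoming,
self-loop) and an update network.  Each node carries a latent vector with `1 + d` coordinates;
messages have `m` coordinates. -/
structure GNNBlock (p d m : ℕ) where
  /-- outgoing messages `Φ_→ (H_i, H_j, a_ij)` -/
  out : MLP (Fin m) (Fin (d + 1) ⊕ Fin (d + 1) ⊕ Unit)
  /-- incoming messages `Φ_← (H_i, H_j, a_ji)` -/
  inc : MLP (Fin m) (Fin (d + 1) ⊕ Fin (d + 1) ⊕ Unit)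
  /-- self-loop messages `Φ_↻ (H_i, a_ii)` -/
  loop : MLP (Fin m) (Fin (d + 1) ⊕ Unit)
  /-- update `Ψ (H_i, b_i, x_i, φ_→, φ_←, φ_↻)` -/
  upd : MLP (Fin (d + 1)) (Fin (d + 1) ⊕ Unit ⊕ Fin p ⊕ Fin m ⊕ Fin m ⊕ Fin m)

namespace GNNBlock

variable {p d m : ℕ}

open Classical in
/-- Sum over the one-hop neighbourhood of `i` of the outgoing messages. -/
noncomputable def msgOut (θ : GNNBlock p d m) (G : GraphProblem p)
    (H : Fin G.N → Fin (d + 1) → ℝ) (i : Fin G.N) : Fin m → ℝ :=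
  ∑ j with G.graph.Adj i j,
    θ.out.eval (Sum.elim (H i) (Sum.elim (H j) fun _ => G.A i j))

open Classical in
/-- Sum over the one-hop neighbourhood of `i` of the incoming messages. -/
noncomputable def msgIn (θ : GNNBlock p d m) (G : GraphProblem p)
    (H : Fin G.N → Fin (d + 1) → ℝ) (i : Fin G.N) : Fin m → ℝ :=
  ∑ j with G.graph.Adj i j,
    θ.inc.eval (Sum.elim (H i) (Sum.elim (H j) fun _ => G.A j i))

/-- The self-loop message. -/
noncomputable def msgLoop (θ : GNNBlock p d m) (G : GraphProblem p)
    (H : Fin G.N → Fin (d + 1) → ℝ) (i : Fin G.N) : Fin m → ℝ :=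
  θ.loop.eval (Sum.elim (H i) fun _ => G.A i i)

/-- The function `h_θ (H, G)`: one step of message passing with residual update.  The implicit
graph neural network with parameters `θ` outputs the fixed point of `H ↦ h_θ (H, G)`. -/
noncomputable def step (θ : GNNBlock p d m) (G : GraphProblem p)
    (H : Fin G.N → Fin (d + 1) → ℝ) : Fin G.N → Fin (d + 1) → ℝ :=
  fun i => H i + θ.upd.eval (Sum.elim (H i) (Sum.elim (fun _ => G.B i) (Sum.elim (G.X i)
    (Sum.elim (θ.msgOut G H i) (Sum.elim (θ.msgIn G H i) (θ.msgLoop G H i))))))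

end GNNBlock

/-- A state `U` of the graph seen as a latent state: identity on the feature, completed by `0` on
the `d` extra dimensions. -/
def embedState {n : ℕ} (d : ℕ) (U : Fin n → ℝ) : Fin n → Fin (d + 1) → ℝ :=
  fun i => Fin.cons (U i) fun _ => 0

/-- The Euclidean norm of a latent state. -/
noncomputable def stateNorm {n d : ℕ} (H : Fin n → Fin (d + 1) → ℝ) : ℝ :=
  Real.sqrt (∑ i, ∑ c, H i c ^ 2)

/-! Uniqueness of the minimizer forces `A` to be invertible, so the minimizer solves `A U = B` and
is the fixed point of the gradient step `u ↦ u - α Aᵀ (A u - B)`. For small `α` this step contracts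
the Euclidean norm, and compactness of the support bounds `N`, `A`, `B` and `A⁻¹` uniformly, so one
`α` and one contraction rate serve all problems.

A gradient step needs two rounds of messages, one for `A` and one for `Aᵀ`. A second latent
coordinate `ρ = c (A u - B)` stores the residual: at a fixed point `ρ` is determined by `u`, and
eliminating it leaves the gradient equation for `u` alone. No contraction of the joint map is
needed.

ReLU networks cannot multiply `a_ij` by `u_j` exactly. `exists_approx_mul` gives a product whose
increments, not just values, are accurate on a box, so the perturbed step remains a contraction
there. Truncating `u` confines every fixed point to that box, which makes uniqueness global
(`exists_unique_fixedPoint_perturbed_gradient`). A small `c` makes the contribution of `ρ` to the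
error negligible. -/

/-! ### ReLU networks with one hidden layer. -/

/-- Affine real functions on `ι → ℝ`. -/
def affineFunctions (ι : Type) [Fintype ι] : Submodule ℝ ((ι → ℝ) → ℝ) where
  carrier := {f | ∃ (w : ι → ℝ) (b : ℝ), ∀ x, f x = ∑ e, w e * x e + b}
  add_mem' := by
    rintro f g ⟨w, b, hf⟩ ⟨v, c, hg⟩
    refine ⟨w + v, b + c, fun x => ?_⟩
    simp only [Pi.add_apply, hf, hg, add_mul, Finset.sum_add_distrib]
    ring
  zero_mem' := ⟨0, 0, fun x => by simp⟩
  smul_mem' := by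
    rintro r f ⟨w, b, hf⟩
    refine ⟨r • w, r * b, fun x => ?_⟩
    simp only [Pi.smul_apply, smul_eq_mul, hf, mul_add, Finset.mul_sum, mul_assoc]

/-- Real functions computed by ReLU networks with one hidden layer. -/
def shallowFunctions (ι : Type) [Fintype ι] : Submodule ℝ ((ι → ℝ) → ℝ) :=
  Submodule.span ℝ {f | ∃ g ∈ affineFunctions ι, f = fun x => max 0 (g x)}

section Shallow

variable {ι : Type} [Fintype ι]

theorem coord_mem_affineFunctions (e : ι) : (fun x : ι → ℝ => x e) ∈ affineFunctions ι := by
  classical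
  exact ⟨Pi.single e 1, 0, fun x => by simp [Pi.single_apply]⟩

theorem const_mem_affineFunctions (c : ℝ) : (fun _ : ι → ℝ => c) ∈ affineFunctions ι :=
  ⟨0, c, fun x => by simp⟩

theorem mul_mem_affineFunctions (c : ℝ) {f : (ι → ℝ) → ℝ} (hf : f ∈ affineFunctions ι) :
    (fun x => c * f x) ∈ affineFunctions ι :=
  (affineFunctions ι).smul_mem c hf

theorem mul_mem_shallowFunctions (c : ℝ) {f : (ι → ℝ) → ℝ} (hf : f ∈ shallowFunctions ι) :
    (fun x => c * f x) ∈ shallowFunctions ι :=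
  (shallowFunctions ι).smul_mem c hf

theorem relu_mem_shallowFunctions {f : (ι → ℝ) → ℝ} (hf : f ∈ affineFunctions ι) :
    (fun x => max 0 (f x)) ∈ shallowFunctions ι :=
  Submodule.subset_span ⟨f, hf, rfl⟩

theorem affineFunctions_le_shallowFunctions : affineFunctions ι ≤ shallowFunctions ι := by
  intro f hf
  have h : f = (fun x => max 0 (f x)) - fun x => max 0 ((-f) x) := by
    ext x
    have := max_zero_sub_eq_self (f x)
    simp only [Pi.sub_apply, Pi.neg_apply, max_comm (0 : ℝ)]
    exact this.symm
  rw [h]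
  exact sub_mem (relu_mem_shallowFunctions hf) (relu_mem_shallowFunctions (neg_mem hf))

/-- Finitely many functions with one hidden layer are the coordinates of one network. -/
theorem exists_MLP_eval_eq {m : ℕ} (f : Fin m → (ι → ℝ) → ℝ)
    (hf : ∀ c, f c ∈ shallowFunctions ι) :
    ∃ net : MLP (Fin m) ι, ∀ x c, net.eval x c = f c x := by
  choose n r g hg using fun c => Submodule.mem_span_set'.1 (hf c)
  choose a ha hga using fun c l => (g c l).2
  choose w b hw using ha
  -- The hidden units of all coordinates are pooled into one layer; output weights linking a
  -- coordinate to another's units are zero.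
  let σ := Fintype.equivFin (Σ c, Fin (n c))
  refine ⟨.hidden _ (fun l => w (σ.symm l).1 (σ.symm l).2)
    (fun l => b (σ.symm l).1 (σ.symm l).2)
    (.output (fun c l => if (σ.symm l).1 = c then r (σ.symm l).1 (σ.symm l).2 else 0) 0),
    fun x c => ?_⟩
  let F : (Σ c, Fin (n c)) → ℝ := fun s =>
    (if s.1 = c then r s.1 s.2 else 0) * max 0 (∑ e, w s.1 s.2 e * x e + b s.1 s.2)
  have sum_F : ∑ l, F (σ.symm l) = f c x := by
    rw [Equiv.sum_comp σ.symm F, Fintype.sum_sigma, Finset.sum_eq_single c]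
    · simp only [← hg c, Finset.sum_apply, Pi.smul_apply, smul_eq_mul]
      exact Finset.sum_congr rfl fun l _ => by rw [hga c l]; simp [F, hw c l]
    · intro c' _ hc
      simp [F, hc]
    · simp
  rw [← sum_F]
  simp only [MLP.eval, Pi.zero_apply, add_zero, F]

end Shallow

/-! ### Truncation and approximate multiplication by ReLU functions. -/

/-- Truncation to the interval `[-R, R]`. -/
def clip (R x : ℝ) : ℝ := max 0 (x + R) - max 0 (x - R) - R

theorem clip_eq_self {R x : ℝ} (h : |x| ≤ R) : clip R x = x := by
  have := abs_le.1 h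
  rw [clip, max_eq_right (by linarith), max_eq_left (by linarith)]
  ring

theorem abs_clip_le {R : ℝ} (hR : 0 ≤ R) (x : ℝ) : |clip R x| ≤ R := by
  rw [clip, abs_le]
  rcases max_cases 0 (x + R) with h | h <;> rcases max_cases 0 (x - R) with h' | h' <;>
    constructor <;> linarith

theorem abs_clip_sub_clip_le {R : ℝ} (hR : 0 ≤ R) (x y : ℝ) :
    |clip R x - clip R y| ≤ |x - y| := by
  wlog hxy : y ≤ x generalizing x y
  · rw [abs_sub_comm, abs_sub_comm x]
    exact this y x (le_of_not_ge hxy)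
  rw [abs_of_nonneg (sub_nonneg.2 hxy), abs_le, clip, clip]
  rcases max_cases 0 (x + R) with h | h <;> rcases max_cases 0 (x - R) with h' | h' <;>
  rcases max_cases 0 (y + R) with k | k <;> rcases max_cases 0 (y - R) with k' | k' <;>
    constructor <;> linarith

/-- A piecewise linear approximation of `(max 0 t) ^ 2` on `(-∞, n * h]`. -/
def halfSquare (n : ℕ) (h t : ℝ) : ℝ := ∑ l ∈ Finset.range n, 2 * h * max 0 (t - l * h)

theorem halfSquare_succ (n : ℕ) (h t : ℝ) :
    halfSquare (n + 1) h t = 2 * h * max 0 t + halfSquare n h (t - h) := by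
  rw [halfSquare, Finset.sum_range_succ', add_comm, halfSquare]
  congr 1
  · simp
  · refine Finset.sum_congr rfl fun l _ => ?_
    push_cast
    ring_nf

/-- On `[l h, (l + 1) h]` with `l < n` the slope is `2 h (l + 1)`, exceeding the derivative `2 t` of
the square by an amount in `[0, 2 h]`. Controlling increments rather than values is what later
preserves the contraction. -/
theorem halfSquare_sub_bounds (n : ℕ) {h : ℝ} (hh : 0 ≤ h) {s t : ℝ} (hst : s ≤ t)
    (ht : t ≤ n * h) :
    0 ≤ halfSquare n h t - halfSquare n h s - (max 0 t ^ 2 - max 0 s ^ 2) ∧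
    halfSquare n h t - halfSquare n h s - (max 0 t ^ 2 - max 0 s ^ 2) ≤
      2 * h * (max 0 t - max 0 s) := by
  induction n generalizing s t with
  | zero =>
    have ht' : t ≤ 0 := by simpa using ht
    simp [halfSquare, max_eq_left ht', max_eq_left (hst.trans ht')]
  | succ n ih =>
    push_cast at ht
    obtain ⟨h1, h2⟩ := ih (sub_le_sub_right hst h) (by linarith : t - h ≤ n * h)
    rw [halfSquare_succ, halfSquare_succ]
    have reluCases : ∀ x : ℝ, (max 0 x = 0 ∧ max 0 (x - h) = 0 ∧ x ≤ 0) ∨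
        (max 0 x = x ∧ max 0 (x - h) = 0 ∧ 0 ≤ x ∧ x ≤ h) ∨
        (max 0 x = x ∧ max 0 (x - h) = x - h ∧ h ≤ x) := by
      intro x
      rcases le_total x 0 with hx | hx
      · exact .inl ⟨max_eq_left hx, max_eq_left (by linarith), hx⟩
      · rcases le_total x h with hx' | hx'
        · exact .inr (.inl ⟨max_eq_right hx, max_eq_left (by linarith), hx, hx'⟩)
        · exact .inr (.inr ⟨max_eq_right hx, max_eq_right (by linarith), hx'⟩)
    have lower : 2 * h * max 0 s + max 0 (s - h) ^ 2 - max 0 s ^ 2 ≤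
        2 * h * max 0 t + max 0 (t - h) ^ 2 - max 0 t ^ 2 := by
      rcases reluCases s with a | a | a <;> rcases reluCases t with b | b | b <;>
      rw [a.1, a.2.1, b.1, b.2.1] <;> nlinarith [a.2.2, b.2.2]
    have upper : max 0 s ^ 2 - max 0 (s - h) ^ 2 - 2 * h * max 0 (s - h) ≤
        max 0 t ^ 2 - max 0 (t - h) ^ 2 - 2 * h * max 0 (t - h) := by
      rcases reluCases s with a | a | a <;> rcases reluCases t with b | b | b <;>
      rw [a.1, a.2.1, b.1, b.2.1] <;> nlinarith [a.2.2, b.2.2]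
    constructor <;> linarith

/-- An even piecewise linear approximation of `t ^ 2` on `[-n * h, n * h]`. -/
def squareApprox (n : ℕ) (h t : ℝ) : ℝ := halfSquare n h t + halfSquare n h (-t)

theorem squareApprox_neg (n : ℕ) (h t : ℝ) : squareApprox n h (-t) = squareApprox n h t := by
  rw [squareApprox, squareApprox, neg_neg, add_comm]

theorem abs_squareApprox_sub_le (n : ℕ) {h : ℝ} (hh : 0 ≤ h) {s t : ℝ}
    (hs : |s| ≤ n * h) (ht : |t| ≤ n * h) :
    |squareApprox n h t - squareApprox n h s - (t ^ 2 - s ^ 2)| ≤ 2 * h * |t - s| := by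
  wlog hst : s ≤ t generalizing s t
  · have := this ht hs (le_of_not_ge hst)
    rw [abs_sub_comm t, ← abs_neg]
    convert this using 2
    ring
  have e1 := halfSquare_sub_bounds n hh hst (abs_le.1 ht).2
  have e2 := halfSquare_sub_bounds n hh (neg_le_neg hst) (by linarith [(abs_le.1 hs).1])
  have sq : ∀ x : ℝ, max 0 x ^ 2 + max 0 (-x) ^ 2 = x ^ 2 := fun x => by
    rcases le_total 0 x with hx | hx
    · rw [max_eq_right hx, max_eq_left (by linarith)]; ring
    · rw [max_eq_left hx, max_eq_right (by linarith)]; ring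
  have l1 : max 0 t - max 0 s ≤ t - s := by
    rcases max_cases 0 t with a | a <;> rcases max_cases 0 s with b | b <;> linarith
  have l2 : max 0 (-s) - max 0 (-t) ≤ t - s := by
    rcases max_cases 0 (-t) with a | a <;> rcases max_cases 0 (-s) with b | b <;> linarith
  have m1 := mul_le_mul_of_nonneg_left l1 (by linarith : 0 ≤ 2 * h)
  have m2 := mul_le_mul_of_nonneg_left l2 (by linarith : 0 ≤ 2 * h)
  rw [abs_of_nonneg (sub_nonneg.2 hst), ← sq t, ← sq s, squareApprox, squareApprox, abs_le]
  constructor <;> linarith [e1.1, e1.2, e2.1, e2.2]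

theorem squareApprox_mem_shallowFunctions {ι : Type} [Fintype ι] (n : ℕ) (h : ℝ)
    {f : (ι → ℝ) → ℝ} (hf : f ∈ affineFunctions ι) :
    (fun x => squareApprox n h (f x)) ∈ shallowFunctions ι := by
  have half : ∀ g ∈ affineFunctions ι, (fun x => halfSquare n h (g x)) ∈ shallowFunctions ι := by
    intro g hg
    have : (fun x => halfSquare n h (g x)) =
        ∑ l ∈ Finset.range n, fun x => 2 * h * max 0 (g x - l * h) := by
      ext x
      simp [halfSquare]
    rw [this]
    exact sum_mem fun l _ => mul_mem_shallowFunctions _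
      (relu_mem_shallowFunctions (sub_mem hg (const_mem_affineFunctions _)))
  exact add_mem (half f hf) (half _ (neg_mem hf))

/-- Multiplication is approximated on a square, together with its increments, by a ReLU network
with one hidden layer. -/
theorem exists_approx_mul {δ R : ℝ} (hδ : 0 < δ) :
    ∃ P : ℝ → ℝ → ℝ,
      (∀ (ι : Type) [Fintype ι] (f g : (ι → ℝ) → ℝ), f ∈ affineFunctions ι →
        g ∈ affineFunctions ι → (fun x => P (f x) (g x)) ∈ shallowFunctions ι) ∧
      (∀ a, P a 0 = 0) ∧ (∀ u, P 0 u = 0) ∧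
      ∀ a u v, |a| ≤ R → |u| ≤ R → |v| ≤ R →
        |P a u - P a v - a * (u - v)| ≤ δ * |u - v| := by
  obtain ⟨n, hn⟩ := exists_nat_ge (2 * R / δ)
  have hn' : 2 * R ≤ n * δ := (div_le_iff₀ hδ).1 hn
  -- Polarization of the approximate square, with mesh `δ`: each square contributes an increment
  -- error of at most `2 δ |u - v|`. Evenness gives `P 0 u = 0`.
  refine ⟨fun a u => (1 / 4) * (squareApprox n δ (a + u) - squareApprox n δ (a - u)),
    ?_, fun a => by simp, fun u => by simp [squareApprox_neg], ?_⟩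
  · intro ι _ f g hf hg
    exact mul_mem_shallowFunctions _ (sub_mem
      (squareApprox_mem_shallowFunctions n δ (add_mem hf hg))
      (squareApprox_mem_shallowFunctions n δ (sub_mem hf hg)))
  · intro a u v ha hu hv
    have bound : ∀ w, |w| ≤ R → |a + w| ≤ n * δ ∧ |a - w| ≤ n * δ := fun w hw =>
      ⟨(abs_add_le a w).trans (by linarith), (abs_sub a w).trans (by linarith)⟩
    have e1 := abs_squareApprox_sub_le n hδ.le (bound v hv).1 (bound u hu).1
    have e2 := abs_squareApprox_sub_le n hδ.le (bound v hv).2 (bound u hu).2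
    rw [show a + u - (a + v) = u - v by ring] at e1
    rw [show a - u - (a - v) = -(u - v) by ring, abs_neg] at e2
    rw [abs_le] at e1 e2 ⊢
    constructor <;> linarith [e1.1, e1.2, e2.1, e2.2]

/-! ### Perturbed gradient descent for least squares. -/

section Euclidean

variable {n : ℕ}

/-- The Euclidean norm of a vector. -/
noncomputable def euclidNorm (x : Fin n → ℝ) : ℝ := ‖WithLp.toLp 2 x‖

theorem euclidNorm_sq (x : Fin n → ℝ) : euclidNorm x ^ 2 = ∑ i, x i ^ 2 :=
  EuclideanSpace.real_norm_sq_eq _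

theorem euclidNorm_nonneg (x : Fin n → ℝ) : 0 ≤ euclidNorm x := norm_nonneg _

theorem euclidNorm_add_le (x y : Fin n → ℝ) :
    euclidNorm (x + y) ≤ euclidNorm x + euclidNorm y :=
  norm_add_le (WithLp.toLp 2 x) (WithLp.toLp 2 y)

theorem euclidNorm_smul (c : ℝ) (x : Fin n → ℝ) : euclidNorm (c • x) = |c| * euclidNorm x :=
  norm_smul c (WithLp.toLp 2 x)

theorem euclidNorm_mono {x y : Fin n → ℝ} (h : ∀ i, |x i| ≤ |y i|) :
    euclidNorm x ≤ euclidNorm y := by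
  refine le_of_sq_le_sq ?_ (euclidNorm_nonneg y)
  rw [euclidNorm_sq, euclidNorm_sq]
  exact Finset.sum_le_sum fun i _ => sq_le_sq.2 (h i)

theorem abs_le_euclidNorm (x : Fin n → ℝ) (i : Fin n) : |x i| ≤ euclidNorm x := by
  refine abs_le_of_sq_le_sq ?_ (euclidNorm_nonneg x)
  rw [euclidNorm_sq]
  exact Finset.single_le_sum (f := fun i => x i ^ 2) (fun i _ => sq_nonneg _) (Finset.mem_univ i)

theorem euclidNorm_le_of_abs_le {x : Fin n → ℝ} {c M : ℝ} (hn : (n : ℝ) ≤ M) (hc : 0 ≤ c)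
    (h : ∀ i, |x i| ≤ c) : euclidNorm x ≤ M * c := by
  refine le_trans (le_of_sq_le_sq ?_ (by positivity)) (mul_le_mul_of_nonneg_right hn hc)
  rw [euclidNorm_sq]
  have hn2 : (n : ℝ) ≤ (n : ℝ) ^ 2 := by exact_mod_cast Nat.le_self_pow two_ne_zero n
  calc ∑ i, x i ^ 2 ≤ ∑ _i : Fin n, c ^ 2 :=
        Finset.sum_le_sum fun i _ => sq_le_sq.2 ((h i).trans (le_abs_self c))
    _ = n * c ^ 2 := by simp
    _ ≤ (n * c) ^ 2 := by
        rw [mul_pow]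
        exact mul_le_mul_of_nonneg_right hn2 (sq_nonneg c)

theorem sum_le_mul_of_le {f : Fin n → ℝ} {c M : ℝ} (hn : (n : ℝ) ≤ M) (hc : 0 ≤ c)
    (h : ∀ i, f i ≤ c) : ∑ i, f i ≤ M * c :=
  calc ∑ i, f i ≤ ∑ _i : Fin n, c := Finset.sum_le_sum fun i _ => h i
    _ = n * c := by simp
    _ ≤ M * c := mul_le_mul_of_nonneg_right hn hc

open Matrix

theorem euclidNorm_mulVec_le {A : Matrix (Fin n) (Fin n) ℝ} {M : ℝ} (hn : (n : ℝ) ≤ M)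
    (hA : ∀ i j, |A i j| ≤ M) (x : Fin n → ℝ) : euclidNorm (A *ᵥ x) ≤ M ^ 3 * euclidNorm x := by
  have hM : 0 ≤ M := n.cast_nonneg.trans hn
  have hx := euclidNorm_nonneg x
  refine (euclidNorm_le_of_abs_le hn (by positivity : 0 ≤ M * (M * euclidNorm x))
    fun i => ?_).trans_eq (by ring)
  refine (Finset.abs_sum_le_sum_abs _ _).trans
    (sum_le_mul_of_le hn (by positivity) fun j => ?_)
  rw [abs_mul]
  exact mul_le_mul (hA i j) (abs_le_euclidNorm x j) (abs_nonneg _) hM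

/-- The product `A *ᵥ u` with the scalar multiplication replaced by `P`. -/
def approxMulVec (P : ℝ → ℝ → ℝ) (A : Matrix (Fin n) (Fin n) ℝ) (u : Fin n → ℝ) : Fin n → ℝ :=
  fun i => ∑ j, P (A i j) (u j)

theorem euclidNorm_approxMulVec_sub_le {P : ℝ → ℝ → ℝ} {δ R M : ℝ} (hδ : 0 ≤ δ)
    (hP : ∀ a u v, |a| ≤ R → |u| ≤ R → |v| ≤ R → |P a u - P a v - a * (u - v)| ≤ δ * |u - v|)
    (hn : (n : ℝ) ≤ M) {A : Matrix (Fin n) (Fin n) ℝ} (hA : ∀ i j, |A i j| ≤ R)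
    {u v : Fin n → ℝ} (hu : ∀ i, |u i| ≤ R) (hv : ∀ i, |v i| ≤ R) :
    euclidNorm (approxMulVec P A u - approxMulVec P A v - A *ᵥ (u - v)) ≤
      M ^ 2 * δ * euclidNorm (u - v) := by
  have hM : 0 ≤ M := n.cast_nonneg.trans hn
  have hx := euclidNorm_nonneg (u - v)
  refine (euclidNorm_le_of_abs_le hn (by positivity : 0 ≤ M * (δ * euclidNorm (u - v)))
    fun i => ?_).trans_eq (by ring)
  have : (approxMulVec P A u - approxMulVec P A v - A *ᵥ (u - v)) i =
      ∑ j, (P (A i j) (u j) - P (A i j) (v j) - A i j * (u j - v j)) := by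
    simp [approxMulVec, mulVec, dotProduct, Finset.sum_sub_distrib]
  rw [this]
  refine (Finset.abs_sum_le_sum_abs _ _).trans
    (sum_le_mul_of_le hn (by positivity) fun j => ?_)
  exact (hP _ _ _ (hA i j) (hu j) (hv j)).trans
    (mul_le_mul_of_nonneg_left (abs_le_euclidNorm (u - v) j) hδ)

/-- A gradient step for the least squares problem contracts the Euclidean norm. -/
theorem euclidNorm_gradient_step_le {A : Matrix (Fin n) (Fin n) ℝ} {C : ℝ} (hC : 1 ≤ C)
    (hT : ∀ x, euclidNorm (Aᵀ *ᵥ x) ≤ C * euclidNorm x)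
    (hinv : ∀ x, euclidNorm x ≤ C * euclidNorm (A *ᵥ x)) (w : Fin n → ℝ) :
    euclidNorm (w - (1 / C ^ 2) • (Aᵀ *ᵥ (A *ᵥ w))) ≤ (1 - 1 / (2 * C ^ 4)) * euclidNorm w := by
  have hC0 : 0 < C := by linarith
  have hC4 : 1 ≤ C ^ 4 := one_le_pow₀ hC
  have hle : 1 / (2 * C ^ 4) ≤ 1 / 2 := one_div_le_one_div_of_le (by norm_num) (by linarith)
  refine le_of_sq_le_sq ?_ (mul_nonneg (by linarith) (euclidNorm_nonneg w))
  have dot : ∀ x : Fin n → ℝ, euclidNorm x ^ 2 = x ⬝ᵥ x := fun x => by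
    rw [euclidNorm_sq]
    simp [dotProduct, sq]
  have adj : w ⬝ᵥ Aᵀ *ᵥ (A *ᵥ w) = euclidNorm (A *ᵥ w) ^ 2 := by
    rw [dot, dotProduct_mulVec, vecMul_transpose]
  have expand : euclidNorm (w - (1 / C ^ 2) • (Aᵀ *ᵥ (A *ᵥ w))) ^ 2 = euclidNorm w ^ 2
      - 2 * (1 / C ^ 2) * euclidNorm (A *ᵥ w) ^ 2
      + (1 / C ^ 2) ^ 2 * euclidNorm (Aᵀ *ᵥ (A *ᵥ w)) ^ 2 := by
    rw [← adj, dot, dot w, dot (Aᵀ *ᵥ (A *ᵥ w))]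
    simp only [sub_dotProduct, dotProduct_sub, smul_dotProduct, dotProduct_smul, smul_eq_mul]
    rw [dotProduct_comm (Aᵀ *ᵥ (A *ᵥ w)) w]
    ring
  have h1 : euclidNorm (Aᵀ *ᵥ (A *ᵥ w)) ^ 2 ≤ C ^ 2 * euclidNorm (A *ᵥ w) ^ 2 := by
    rw [← mul_pow]
    exact pow_le_pow_left₀ (euclidNorm_nonneg _) (hT _) 2
  have h2 : euclidNorm w ^ 2 ≤ C ^ 2 * euclidNorm (A *ᵥ w) ^ 2 := by
    rw [← mul_pow]
    exact pow_le_pow_left₀ (euclidNorm_nonneg _) (hinv _) 2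
  have h3 : (1 / C ^ 2) ^ 2 * euclidNorm (Aᵀ *ᵥ (A *ᵥ w)) ^ 2 ≤
      1 / C ^ 2 * euclidNorm (A *ᵥ w) ^ 2 := by
    refine (mul_le_mul_of_nonneg_left h1 (by positivity)).trans_eq ?_
    field_simp
  have h4 : 1 / C ^ 4 * euclidNorm w ^ 2 ≤ 1 / C ^ 2 * euclidNorm (A *ᵥ w) ^ 2 := by
    refine (mul_le_mul_of_nonneg_left h2 (by positivity)).trans_eq ?_
    field_simp
  have h5 : 1 / C ^ 4 = 2 * (1 / (2 * C ^ 4)) := by field_simp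
  rw [expand, mul_pow]
  rw [h5] at h4
  -- The squared factor is at most `1 - 2 x ≤ (1 - x) ^ 2` with `x = 1 / (2 * C ^ 4)`.
  nlinarith [mul_nonneg (sq_nonneg (1 / (2 * C ^ 4))) (sq_nonneg (euclidNorm w))]

theorem exists_fixedPoint_of_contraction {f : (Fin n → ℝ) → (Fin n → ℝ)} {q : ℝ} (hq0 : 0 ≤ q)
    (hq : q < 1) (hf : ∀ u v, euclidNorm (f u - f v) ≤ q * euclidNorm (u - v)) :
    ∃ u, f u = u := by
  let g : EuclideanSpace ℝ (Fin n) → EuclideanSpace ℝ (Fin n) :=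
    fun x => WithLp.toLp 2 (f (WithLp.ofLp x))
  have hg : ContractingWith ⟨q, hq0⟩ g := by
    refine ⟨by exact_mod_cast hq, LipschitzWith.of_dist_le_mul fun x y => ?_⟩
    rw [dist_eq_norm, dist_eq_norm]
    exact hf _ _
  exact ⟨WithLp.ofLp (ContractingWith.fixedPoint g hg),
    congrArg WithLp.ofLp hg.fixedPoint_isFixedPt⟩

/-- Gradient descent with perturbed matrix products, truncated to a box: there is exactly one
fixed point in the box, and it is close to the solution of the unperturbed problem. -/
theorem exists_unique_fixedPoint_perturbed_gradient {A : Matrix (Fin n) (Fin n) ℝ}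
    {C M R η ε : ℝ} (hC : 1 ≤ C) (hM : 0 ≤ M) (hη : 0 ≤ η) (hε : ε ≤ 1)
    (hηε : 12 * C ^ 6 * η ≤ ε)
    (hA : ∀ x, euclidNorm (A *ᵥ x) ≤ C * euclidNorm x)
    (hT : ∀ x, euclidNorm (Aᵀ *ᵥ x) ≤ C * euclidNorm x)
    (hinv : ∀ x, euclidNorm x ≤ C * euclidNorm (A *ᵥ x))
    {F B : (Fin n → ℝ) → (Fin n → ℝ)}
    (hF : ∀ u v, (∀ i, |u i| ≤ M) → (∀ i, |v i| ≤ M) →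
      euclidNorm (F u - F v - A *ᵥ (u - v)) ≤ η * euclidNorm (u - v))
    (hFR : ∀ u, (∀ i, |u i| ≤ M) → ∀ i, |F u i| ≤ R)
    (hB : ∀ r s, (∀ i, |r i| ≤ R) → (∀ i, |s i| ≤ R) →
      euclidNorm (B r - B s - Aᵀ *ᵥ (r - s)) ≤ η * euclidNorm (r - s))
    (hB0 : B 0 = 0) {U : Fin n → ℝ} (hU : ∀ i, |U i| ≤ M) (hFU : euclidNorm (F U) ≤ η * C) :
    ∃ u : Fin n → ℝ, (∀ i, |u i| ≤ M) ∧
      (∀ i, clip M (u i - 1 / C ^ 2 * B (F u) i) = u i) ∧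
      (∀ v : Fin n → ℝ, (∀ i, |v i| ≤ M) →
        (∀ i, clip M (v i - 1 / C ^ 2 * B (F v) i) = v i) → v = u) ∧
      euclidNorm (u - U) ≤ ε := by
  have hC0 : 0 < C := by linarith
  have hCp : ∀ k : ℕ, 1 ≤ C ^ k := fun k => one_le_pow₀ hC
  have hα0 : 0 ≤ 1 / C ^ 2 := by positivity
  have hα1 : 1 / C ^ 2 ≤ 1 := (div_le_one (by positivity)).2 (hCp 2)
  have hη1 : η ≤ C := by nlinarith [hCp 6]
  have hκ : 3 * C * η ≤ 1 / (4 * C ^ 4) := by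
    rw [le_div_iff₀ (by positivity)]
    have : C ^ 5 ≤ C ^ 6 := pow_le_pow_right₀ hC (by norm_num)
    nlinarith
  set κ := 1 / (4 * C ^ 4) with hκdef
  have hκ0 : 0 < κ := by positivity
  -- The exact step gains `2 κ`; the perturbation will cost at most `κ`, leaving the rate `1 - κ`.
  have hκ1 : κ ≤ 1 / 4 := one_div_le_one_div_of_le (by norm_num) (by linarith [hCp 4])
  have h2κ : 1 / (2 * C ^ 4) = 2 * κ := by rw [hκdef]; field_simp; norm_num
  set S : (Fin n → ℝ) → (Fin n → ℝ) := fun u => u - (1 / C ^ 2) • B (F u) with hS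
  have contr : ∀ u v, (∀ i, |u i| ≤ M) → (∀ i, |v i| ≤ M) →
      euclidNorm (S u - S v) ≤ (1 - κ) * euclidNorm (u - v) := by
    intro u v hu hv
    set w := u - v with hw
    have e1 := hF u v hu hv
    have e2 := hB _ _ (hFR u hu) (hFR v hv)
    set d := F u - F v with hd
    have hdw : euclidNorm d ≤ 2 * C * euclidNorm w := by
      have := euclidNorm_add_le (d - A *ᵥ w) (A *ᵥ w)
      rw [sub_add_cancel] at this
      nlinarith [hA w, mul_le_mul_of_nonneg_right hη1 (euclidNorm_nonneg w)]
    -- Exact gradient step on `w`, plus the error of `F` pushed through `Aᵀ`, plus the error of `B`.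
    have split : S u - S v = (w - (1 / C ^ 2) • (Aᵀ *ᵥ (A *ᵥ w)))
        + (-(1 / C ^ 2)) • (Aᵀ *ᵥ (d - A *ᵥ w) + (B (F u) - B (F v) - Aᵀ *ᵥ d)) := by
      rw [mulVec_sub Aᵀ d (A *ᵥ w)]
      ext i
      have : w i = u i - v i := rfl
      simp only [hS, Pi.sub_apply, Pi.add_apply, Pi.smul_apply, smul_eq_mul, this]
      ring
    have t1 := euclidNorm_gradient_step_le hC hT hinv w
    have t2 : euclidNorm (Aᵀ *ᵥ (d - A *ᵥ w) + (B (F u) - B (F v) - Aᵀ *ᵥ d)) ≤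
        3 * C * η * euclidNorm w := by
      refine (euclidNorm_add_le _ _).trans ?_
      have a1 := (hT (d - A *ᵥ w)).trans (mul_le_mul_of_nonneg_left e1 hC0.le)
      have a2 := e2.trans (mul_le_mul_of_nonneg_left hdw hη)
      linarith
    rw [split]
    refine (euclidNorm_add_le _ _).trans ?_
    rw [euclidNorm_smul, abs_neg, abs_of_nonneg hα0]
    have t3 : 1 / C ^ 2 * euclidNorm (Aᵀ *ᵥ (d - A *ᵥ w) + (B (F u) - B (F v) - Aᵀ *ᵥ d)) ≤
        κ * euclidNorm w :=
      calc _ ≤ 1 * (3 * C * η * euclidNorm w) :=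
            mul_le_mul hα1 t2 (euclidNorm_nonneg _) zero_le_one
        _ ≤ κ * euclidNorm w := by
            rw [one_mul]
            exact mul_le_mul_of_nonneg_right hκ (euclidNorm_nonneg w)
    rw [h2κ] at t1
    linarith
  have clip_le : ∀ x y : Fin n → ℝ,
      euclidNorm ((fun i => clip M (x i)) - fun i => clip M (y i)) ≤ euclidNorm (x - y) :=
    fun x y => euclidNorm_mono fun i => abs_clip_sub_clip_le hM _ _
  have clipU : (fun i => clip M (U i)) = U := funext fun i => clip_eq_self (hU i)
  -- `S` is controlled only on the box, so the argument is clipped too; the result is a contraction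
  -- of the whole space, and its fixed point lies in the box, where the inner clip is the identity.
  obtain ⟨u, hu⟩ : ∃ u : Fin n → ℝ, (fun i => clip M (S (fun j => clip M (u j)) i)) = u := by
    refine exists_fixedPoint_of_contraction (q := 1 - κ) (by linarith) (by linarith)
      fun u v => ?_
    refine (clip_le _ _).trans ((contr _ _ (fun i => abs_clip_le hM _)
      fun i => abs_clip_le hM _).trans ?_)
    exact mul_le_mul_of_nonneg_left (clip_le u v) (by linarith)
  have hubox : ∀ i, |u i| ≤ M := fun i => by
    rw [← hu]
    exact abs_clip_le hM _
  have hclipu : (fun j => clip M (u j)) = u := funext fun i => clip_eq_self (hubox i)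
  rw [hclipu] at hu
  refine ⟨u, hubox, fun i => congrFun hu i, fun v hv hfix => ?_, ?_⟩
  · have hv' : (fun i => clip M (S v i)) = v := funext hfix
    have h1 := (clip_le (S v) (S u)).trans (contr v u hv hubox)
    rw [hv', hu] at h1
    have h0 : euclidNorm (v - u) = 0 := by nlinarith [euclidNorm_nonneg (v - u)]
    have : ∀ i, v i - u i = 0 := fun i => by
      have := abs_le_euclidNorm (v - u) i
      rw [h0] at this
      exact abs_nonpos_iff.1 this
    exact funext fun i => sub_eq_zero.1 (this i)
  · have hR : ∀ i, |(0 : Fin n → ℝ) i| ≤ R := fun i => by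
      simpa using (abs_nonneg _).trans (hFR U hU i)
    have hBF : euclidNorm (B (F U)) ≤ 2 * C ^ 2 * η := by
      have e := hB (F U) 0 (hFR U hU) hR
      rw [hB0, sub_zero, sub_zero] at e
      have h := euclidNorm_add_le (B (F U) - Aᵀ *ᵥ F U) (Aᵀ *ᵥ F U)
      rw [sub_add_cancel] at h
      have h' : euclidNorm (B (F U)) ≤ 2 * C * euclidNorm (F U) := by
        nlinarith [hT (F U), mul_le_mul_of_nonneg_right hη1 (euclidNorm_nonneg (F U))]
      nlinarith
    have hSU : euclidNorm (S U - U) ≤ 2 * C ^ 2 * η := by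
      have : S U - U = (-(1 / C ^ 2)) • B (F U) := by
        simp only [hS]
        module
      rw [this, euclidNorm_smul, abs_neg, abs_of_nonneg hα0]
      nlinarith [euclidNorm_nonneg (B (F U))]
    -- A posteriori estimate: since `clip` fixes `U`, the distance to `U` is at most `‖S U - U‖ / κ
    -- ≤ 8 * C ^ 6 * η`.
    have h1 : euclidNorm (u - U) ≤ euclidNorm (S u - U) := by
      have := clip_le (S u) U
      rwa [hu, clipU] at this
    have h2 := euclidNorm_add_le (S u - S U) (S U - U)
    rw [sub_add_sub_cancel] at h2
    have h3 := contr u U hubox hU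
    have h4 : κ * euclidNorm (u - U) ≤ 2 * C ^ 2 * η := by linarith
    rw [hκdef, one_div_mul_eq_div, div_le_iff₀ (by positivity)] at h4
    have : 2 * C ^ 2 * η * (4 * C ^ 4) = 8 * C ^ 6 * η := by ring
    nlinarith [mul_nonneg (pow_nonneg hC0.le 6) hη]

end Euclidean

/-! ### Uniform bounds and solvability on the support. -/

namespace GraphProblem

open Matrix

variable {p : ℕ}

theorem continuous_of_continuous_data
    {g : ∀ N : ℕ, Matrix (Fin N) (Fin N) ℝ × (Fin N → ℝ) × (Fin N → Fin p → ℝ) → ℝ}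
    (hg : ∀ N, Continuous (g N)) :
    Continuous fun G : GraphProblem p => g G.N (G.A, G.B, G.X) :=
  (continuous_sigma (f := fun s : Σ N : ℕ,
    Matrix (Fin N) (Fin N) ℝ × (Fin N → ℝ) × (Fin N → Fin p → ℝ) => g s.1 s.2) hg).comp
    (continuous_induced_dom (f := data))

/-- On a compact set of problems with invertible matrices, the sizes, the data and the inverse
matrices are uniformly bounded. -/
theorem exists_uniform_bound {K : Set (GraphProblem p)} (hK : IsCompact K)
    (hdet : ∀ G ∈ K, G.A.det ≠ 0) :
    ∃ M : ℝ, 1 ≤ M ∧ ∀ G ∈ K, (G.N : ℝ) ≤ M ∧ (∀ i j, |G.A i j| ≤ M) ∧ (∀ i, |G.B i| ≤ M) ∧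
      ∀ i j, |G.A⁻¹ i j| ≤ M := by
  have c1 : Continuous fun G : GraphProblem p => (G.N : ℝ) :=
    continuous_of_continuous_data (g := fun N _ => (N : ℝ)) fun N => continuous_const
  have c2 : Continuous fun G : GraphProblem p => ∑ i, ∑ j, |G.A i j| :=
    continuous_of_continuous_data (g := fun N s => ∑ i, ∑ j, |s.1 i j|) fun N => by fun_prop
  have c3 : Continuous fun G : GraphProblem p => ∑ i, |G.B i| :=
    continuous_of_continuous_data (g := fun N s => ∑ i, |s.2.1 i|) fun N => by fun_prop
  have c4 : Continuous fun G : GraphProblem p => ∑ i, ∑ j, |G.A.adjugate i j| :=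
    continuous_of_continuous_data (g := fun N s => ∑ i, ∑ j, |s.1.adjugate i j|) fun N =>
      continuous_finsetSum _ fun i _ => continuous_finsetSum _ fun j _ =>
        (continuous_fst.matrix_adjugate.matrix_elem i j).abs
  have c5 : Continuous fun G : GraphProblem p => G.A.det :=
    continuous_of_continuous_data (g := fun N s => s.1.det) fun N => continuous_fst.matrix_det
  obtain ⟨M1, h1⟩ := hK.exists_bound_of_continuousOn c1.continuousOn
  obtain ⟨M2, h2⟩ := hK.exists_bound_of_continuousOn c2.continuousOn
  obtain ⟨M3, h3⟩ := hK.exists_bound_of_continuousOn c3.continuousOn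
  -- The inverse is the adjugate over the determinant, hence continuous where the determinant is
  -- nonzero.
  obtain ⟨M4, h4⟩ := hK.exists_bound_of_continuousOn (c4.continuousOn.div c5.continuousOn hdet)
  have entry : ∀ {n : ℕ} (W : Matrix (Fin n) (Fin n) ℝ) (i j : Fin n),
      |W i j| ≤ ∑ i, ∑ j, |W i j| := fun W i j =>
    (Finset.single_le_sum (f := fun j => |W i j|) (fun _ _ => abs_nonneg _)
      (Finset.mem_univ j)).trans
    (Finset.single_le_sum (f := fun i => ∑ j, |W i j|)
      (fun _ _ => Finset.sum_nonneg fun _ _ => abs_nonneg _) (Finset.mem_univ i))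
  refine ⟨max 1 (max (max M1 M2) (max M3 M4)), le_max_left _ _, fun G hG =>
    ⟨?_, fun i j => ?_, fun i => ?_, fun i j => ?_⟩⟩
  · exact ((le_abs_self _).trans (h1 G hG)).trans (by simp)
  · exact (((entry G.A i j).trans (le_abs_self _)).trans (h2 G hG)).trans (by simp)
  · exact (((Finset.single_le_sum (f := fun i => |G.B i|) (fun _ _ => abs_nonneg _)
      (Finset.mem_univ i)).trans (le_abs_self _)).trans (h3 G hG)).trans (by simp)
  · have h := h4 G hG
    rw [Pi.div_apply, norm_div, Real.norm_eq_abs, Real.norm_eq_abs] at h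
    have e : |G.A⁻¹ i j| = |G.A.adjugate i j| / |G.A.det| := by
      rw [Matrix.inv_def, Ring.inverse_eq_inv', Matrix.smul_apply, smul_eq_mul, abs_mul, abs_inv,
        inv_mul_eq_div]
    rw [e]
    exact ((div_le_div_of_nonneg_right ((entry G.A.adjugate i j).trans (le_abs_self _))
      (abs_nonneg _)).trans h).trans (by simp)

theorem residualLoss_eq (G : GraphProblem p) (U : Fin G.N → ℝ) :
    G.residualLoss U = (1 / (G.N : ℝ)) * ∑ i, (-G.B i + (G.A *ᵥ U) i) ^ 2 := rfl

/-- Adding a kernel vector to a minimizer leaves the loss unchanged. -/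
theorem det_ne_zero_of_existsUnique_isOptimal {G : GraphProblem p}
    (h : ∃! U, G.IsOptimal U) : G.A.det ≠ 0 := by
  obtain ⟨U, hU, huniq⟩ := h
  intro hdet
  obtain ⟨v, hv0, hv⟩ := Matrix.exists_mulVec_eq_zero_iff.2 hdet
  refine hv0 ?_
  have hopt : G.IsOptimal (U + v) := fun V => by
    have : G.residualLoss (U + v) = G.residualLoss U := by
      rw [residualLoss_eq, residualLoss_eq, mulVec_add, hv, add_zero]
    exact this.trans_le (hU V)
  simpa using huniq _ hopt

theorem isOptimal_of_mulVec_eq {G : GraphProblem p} {U : Fin G.N → ℝ} (h : G.A *ᵥ U = G.B) :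
    G.IsOptimal U := fun V => by
  have : G.residualLoss U = 0 := by simp [residualLoss_eq, h]
  rw [this, residualLoss_eq]
  positivity

/-- Because `P 0 u = 0`, non-neighbours contribute nothing, so the messages of a node add up to a
full row of the matrix product. -/
theorem sum_adj_add_self {G : GraphProblem p} {P : ℝ → ℝ → ℝ} (hP : ∀ u, P 0 u = 0)
    {W : Matrix (Fin G.N) (Fin G.N) ℝ} [DecidableRel G.graph.Adj] (i : Fin G.N)
    (hW : ∀ j, i ≠ j → ¬ G.graph.Adj i j → W i j = 0) (u : Fin G.N → ℝ) :
    (∑ j with G.graph.Adj i j, P (W i j) (u j)) + P (W i i) (u i) = approxMulVec P W u i := by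
  have hself : P (W i i) (u i) = ∑ j, if i = j then P (W i j) (u j) else 0 := by simp
  rw [hself, Finset.sum_filter, ← Finset.sum_add_distrib, approxMulVec]
  refine Finset.sum_congr rfl fun j _ => ?_
  by_cases hij : i = j
  · subst hij
    simp
  · by_cases hadj : G.graph.Adj i j
    · simp [hij, hadj]
    · simp [hij, hadj, hW j hij hadj, hP]

end GraphProblem

/-! ### The block and its fixed points. -/

open Matrix in
/-- A block with latent state `(u, ρ)` that performs a truncated gradient step on `u`, while `ρ`
holds the residual scaled by `c`; products are replaced by `P`. -/
theorem exists_GNNBlock_step_eq (p : ℕ) {P : ℝ → ℝ → ℝ} (R α c : ℝ)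
    (hPnet : ∀ (ι : Type) [Fintype ι] (f g : (ι → ℝ) → ℝ), f ∈ affineFunctions ι →
      g ∈ affineFunctions ι → (fun x => P (f x) (g x)) ∈ shallowFunctions ι)
    (hP0 : ∀ u, P 0 u = 0) :
    ∃ θ : GNNBlock p 1 2, ∀ (G : GraphProblem p) (H : Fin G.N → Fin 2 → ℝ) (i : Fin G.N),
      θ.step G H i 0 =
        clip R (H i 0 - α * approxMulVec P G.Aᵀ (fun j => c⁻¹ * H j 1) i) ∧
      θ.step G H i 1 = c * (approxMulVec P G.A (fun j => H j 0) i - G.B i) := by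
  obtain ⟨out, hout⟩ := exists_MLP_eval_eq (ι := Fin (1 + 1) ⊕ Fin (1 + 1) ⊕ Unit)
    ![fun x => P (x (.inr (.inr ()))) (x (.inr (.inl 0))), fun _ => 0] (by
      intro k
      fin_cases k
      · exact hPnet _ _ _ (coord_mem_affineFunctions _) (coord_mem_affineFunctions _)
      · exact zero_mem _)
  obtain ⟨inc, hinc⟩ := exists_MLP_eval_eq (ι := Fin (1 + 1) ⊕ Fin (1 + 1) ⊕ Unit)
    ![fun _ => 0, fun x => P (x (.inr (.inr ()))) (c⁻¹ * x (.inr (.inl 1)))] (by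
      intro k
      fin_cases k
      · exact zero_mem _
      · exact hPnet _ _ _ (coord_mem_affineFunctions _)
          (mul_mem_affineFunctions _ (coord_mem_affineFunctions _)))
  obtain ⟨loop, hloop⟩ := exists_MLP_eval_eq (ι := Fin (1 + 1) ⊕ Unit)
    ![fun x => P (x (.inr ())) (x (.inl 0)), fun x => P (x (.inr ())) (c⁻¹ * x (.inl 1))] (by
      intro k
      fin_cases k
      · exact hPnet _ _ _ (coord_mem_affineFunctions _) (coord_mem_affineFunctions _)
      · exact hPnet _ _ _ (coord_mem_affineFunctions _)
          (mul_mem_affineFunctions _ (coord_mem_affineFunctions _)))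
  -- Message channel `0` carries `A u` and channel `1` carries `Aᵀ (c⁻¹ ρ)`. The subtracted latent
  -- coordinates cancel the residual connection.
  obtain ⟨upd, hupd⟩ := exists_MLP_eval_eq
    (ι := Fin (1 + 1) ⊕ Unit ⊕ Fin p ⊕ Fin 2 ⊕ Fin 2 ⊕ Fin 2)
    ![fun x => clip R (x (.inl 0) - α * (x (.inr (.inr (.inr (.inr (.inl 1))))) +
        x (.inr (.inr (.inr (.inr (.inr 1))))))) - x (.inl 0),
      fun x => c * (x (.inr (.inr (.inr (.inl 0)))) + x (.inr (.inr (.inr (.inr (.inr 0))))) -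
        x (.inr (.inl ()))) - x (.inl 1)] (by
      intro k
      have co := fun e => coord_mem_affineFunctions
        (ι := Fin (1 + 1) ⊕ Unit ⊕ Fin p ⊕ Fin 2 ⊕ Fin 2 ⊕ Fin 2) e
      fin_cases k
      · have arg := sub_mem (co (.inl 0)) (mul_mem_affineFunctions α (add_mem
          (co (.inr (.inr (.inr (.inr (.inl 1))))))
          (co (.inr (.inr (.inr (.inr (.inr 1))))))))
        exact sub_mem (sub_mem (sub_mem
          (relu_mem_shallowFunctions (add_mem arg (const_mem_affineFunctions R)))
          (relu_mem_shallowFunctions (sub_mem arg (const_mem_affineFunctions R))))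
          (affineFunctions_le_shallowFunctions (const_mem_affineFunctions R)))
          (affineFunctions_le_shallowFunctions (co (.inl 0)))
      · exact affineFunctions_le_shallowFunctions (sub_mem (mul_mem_affineFunctions c
          (sub_mem (add_mem (co _) (co _)) (co _))) (co _)))
  refine ⟨⟨out, inc, loop, upd⟩, fun G H i => ?_⟩
  classical
  have sumOut := GraphProblem.sum_adj_add_self hP0 (W := G.A) i
    (fun j hij hadj => by
      by_contra h
      exact hadj ⟨hij, .inl h⟩) (fun j => H j 0)
  have sumIn := GraphProblem.sum_adj_add_self hP0 (W := G.Aᵀ) i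
    (fun j hij hadj => by
      by_contra h
      exact hadj ⟨hij, .inr h⟩) (fun j => c⁻¹ * H j 1)
  rw [← sumOut, ← sumIn]
  simp only [Matrix.transpose_apply]
  constructor
  · rw [GNNBlock.step, Pi.add_apply]
    rw [hupd]
    simp [GNNBlock.msgIn, GNNBlock.msgLoop, hinc, hloop, Finset.sum_apply]
  · rw [GNNBlock.step, Pi.add_apply]
    rw [hupd]
    simp [GNNBlock.msgOut, GNNBlock.msgLoop, hout, hloop, Finset.sum_apply]

theorem stateNorm_le {n : ℕ} {H : Fin n → Fin 2 → ℝ} {ε : ℝ} (hε : 0 ≤ ε)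
    (h0 : euclidNorm (fun i => H i 0) ≤ ε / 2) (h1 : euclidNorm (fun i => H i 1) ≤ ε / 2) :
    stateNorm (d := 1) H ≤ ε := by
  refine Real.sqrt_le_iff.2 ⟨hε, ?_⟩
  have e : ∑ i, ∑ c : Fin (1 + 1), H i c ^ 2 =
      euclidNorm (fun i => H i 0) ^ 2 + euclidNorm (fun i => H i 1) ^ 2 := by
    rw [euclidNorm_sq, euclidNorm_sq, ← Finset.sum_add_distrib]
    exact Finset.sum_congr rfl fun i _ => Fin.sum_univ_two _
  rw [e]
  nlinarith [euclidNorm_nonneg (fun i => H i 0), euclidNorm_nonneg (fun i => H i 1)]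

open Matrix in
/-- Uniform estimates for the perturbed residual and gradient of a bounded problem. -/
theorem exists_unique_fixedPoint_of_bounds {n : ℕ} {A : Matrix (Fin n) (Fin n) ℝ}
    {b : Fin n → ℝ} {M δ ε : ℝ} {P : ℝ → ℝ → ℝ} (hM : 1 ≤ M) (hδ : 0 < δ) (hε : ε ≤ 1)
    (hδε : 12 * M ^ 26 * δ ≤ ε) (hP0 : ∀ a, P a 0 = 0)
    (hP : ∀ a u v, |a| ≤ 3 * M ^ 5 → |u| ≤ 3 * M ^ 5 → |v| ≤ 3 * M ^ 5 →
      |P a u - P a v - a * (u - v)| ≤ δ * |u - v|)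
    (hn : (n : ℝ) ≤ M) (hA : ∀ i j, |A i j| ≤ M) (hb : ∀ i, |b i| ≤ M)
    (hinv : ∀ i j, |A⁻¹ i j| ≤ M) (hdet : A.det ≠ 0) :
    ∃ u : Fin n → ℝ,
      (∀ i, |approxMulVec P A u i - b i| ≤ 3 * M ^ 5) ∧
      (∀ i, |u i| ≤ M ^ 3) ∧
      (∀ i, clip (M ^ 3) (u i - 1 / (M ^ 4) ^ 2 *
        approxMulVec P Aᵀ (approxMulVec P A u - b) i) = u i) ∧
      (∀ v : Fin n → ℝ, (∀ i, |v i| ≤ M ^ 3) →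
        (∀ i, clip (M ^ 3) (v i - 1 / (M ^ 4) ^ 2 *
          approxMulVec P Aᵀ (approxMulVec P A v - b) i) = v i) → v = u) ∧
      euclidNorm (u - A⁻¹ *ᵥ b) ≤ ε := by
  have hM0 : 0 < M := by linarith
  have hpow : ∀ {k l : ℕ}, k ≤ l → M ^ k ≤ M ^ l := fun h => pow_le_pow_right₀ hM h
  have hM1 : M ≤ 3 * M ^ 5 := by
    have := hpow (show 1 ≤ 5 by norm_num)
    rw [pow_one] at this
    linarith [pow_pos hM0 5]
  have hM3 : M ^ 3 ≤ 3 * M ^ 5 := by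
    linarith [hpow (show 3 ≤ 5 by norm_num), pow_pos hM0 5]
  have hδ1 : δ ≤ 1 := by
    have := mul_le_mul_of_nonneg_right (one_le_pow₀ hM : 1 ≤ M ^ 26) hδ.le
    linarith
  have hC : M ^ 3 ≤ M ^ 4 := hpow (by norm_num)
  have mono : ∀ {W : Matrix (Fin n) (Fin n) ℝ}, (∀ i j, |W i j| ≤ M) →
      ∀ x, euclidNorm (W *ᵥ x) ≤ M ^ 4 * euclidNorm x := fun hW x =>
    (euclidNorm_mulVec_le hn hW x).trans (mul_le_mul_of_nonneg_right hC (euclidNorm_nonneg x))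
  have hunit : IsUnit A.det := isUnit_iff_ne_zero.2 hdet
  have hU : ∀ i, |(A⁻¹ *ᵥ b) i| ≤ M ^ 3 := fun i => by
    refine ((Finset.abs_sum_le_sum_abs _ _).trans
      (sum_le_mul_of_le hn (by positivity : 0 ≤ M * M) fun j => ?_)).trans_eq (by ring)
    rw [abs_mul]
    exact mul_le_mul (hinv i j) (hb j) (abs_nonneg _) hM0.le
  have hAU : A *ᵥ (A⁻¹ *ᵥ b) = b := by
    rw [mulVec_mulVec, mul_nonsing_inv _ hunit, one_mulVec]
  have happ0 : ∀ W : Matrix (Fin n) (Fin n) ℝ, approxMulVec P W 0 = 0 := fun W => by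
    ext i
    simp [approxMulVec, hP0]
  have hFR : ∀ u : Fin n → ℝ, (∀ i, |u i| ≤ M ^ 3) →
      ∀ i, |(approxMulVec P A u - b) i| ≤ 3 * M ^ 5 := by
    intro u hu i
    have h1 : |approxMulVec P A u i| ≤ M * (2 * M ^ 4) := by
      refine (Finset.abs_sum_le_sum_abs _ _).trans
        (sum_le_mul_of_le hn (by positivity) fun j => ?_)
      have h := hP (A i j) (u j) 0 ((hA i j).trans hM1) ((hu j).trans hM3)
        (by simp; positivity)
      rw [hP0, sub_zero, sub_zero] at h
      have h2 : |A i j * u j| ≤ M * M ^ 3 := by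
        rw [abs_mul]
        exact mul_le_mul (hA i j) (hu j) (abs_nonneg _) hM0.le
      have h3 : δ * |u j| ≤ 1 * M ^ 3 := mul_le_mul hδ1 (hu j) (abs_nonneg _) zero_le_one
      have h4 := abs_add_le (P (A i j) (u j) - A i j * u j) (A i j * u j)
      rw [sub_add_cancel] at h4
      have : M * M ^ 3 = M ^ 4 := by ring
      linarith
    have h5 : M ^ 1 ≤ M ^ 5 := hpow (by norm_num)
    rw [pow_one] at h5
    rw [Pi.sub_apply]
    refine (abs_sub _ _).trans ?_
    linarith [hb i, show M * (2 * M ^ 4) = 2 * M ^ 5 by ring]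
  have hF : ∀ u v : Fin n → ℝ, (∀ i, |u i| ≤ M ^ 3) → (∀ i, |v i| ≤ M ^ 3) →
      euclidNorm ((approxMulVec P A u - b) - (approxMulVec P A v - b) - A *ᵥ (u - v)) ≤
        M ^ 2 * δ * euclidNorm (u - v) := by
    intro u v hu hv
    rw [sub_sub_sub_cancel_right]
    exact euclidNorm_approxMulVec_sub_le hδ.le hP hn (fun i j => (hA i j).trans hM1)
      (fun i => (hu i).trans hM3) (fun i => (hv i).trans hM3)
  -- The box `M ^ 3` contains `A⁻¹ b`, and `3 * M ^ 5` bounds the perturbed residual on it. The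
  -- value `C = M ^ 4` bounds both the operator norms (at most `M ^ 3`) and the norm of the
  -- solution.
  obtain ⟨u, h1, h2, h3, h4⟩ := exists_unique_fixedPoint_perturbed_gradient (A := A)
    (C := M ^ 4) (M := M ^ 3) (R := 3 * M ^ 5) (η := M ^ 2 * δ) (ε := ε)
    (F := fun u => approxMulVec P A u - b) (B := approxMulVec P Aᵀ) (U := A⁻¹ *ᵥ b)
    (one_le_pow₀ hM) (by positivity) (by positivity) hε
    (by linarith [show 12 * (M ^ 4) ^ 6 * (M ^ 2 * δ) = 12 * M ^ 26 * δ by ring])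
    (mono hA) (mono fun i j => hA j i)
    (fun x => by
      have := mono hinv (A *ᵥ x)
      rwa [mulVec_mulVec, nonsing_inv_mul _ hunit, one_mulVec] at this)
    hF hFR
    (fun r s hr hs => euclidNorm_approxMulVec_sub_le hδ.le hP hn
      (fun i j => (hA j i).trans hM1) hr hs)
    (happ0 _) hU
    (by
      -- As `F 0 = -b` and `A U = b`, the increment bound between `U` and `0` is a bound on `F U`
      -- itself.
      have h := hF (A⁻¹ *ᵥ b) 0 hU (fun i => by simp; positivity)
      rw [sub_zero, happ0, zero_sub, hAU, sub_neg_eq_add, add_sub_cancel_right] at h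
      refine h.trans (mul_le_mul_of_nonneg_left ?_ (by positivity))
      exact (euclidNorm_le_of_abs_le hn (by positivity) hU).trans_eq (by ring))
  exact ⟨u, hFR u h1, h1, h2, h3, h4⟩

theorem mainTheorem2 (p : ℕ) (D : Measure (GraphProblem p)) [IsProbabilityMeasure D]
    (hcompact : IsCompact D.support)
    (hconn : ∀ G ∈ D.support, G.graph.Connected)
    (hident : ∀ G ∈ D.support, G.Identifiable)
    (huniq : ∀ G ∈ D.support, ∃! U, G.IsOptimal U)
    (ε : ℝ) (hε : 0 < ε) :
    ∃ (d m : ℕ) (θ : GNNBlock p d m), ∀ G ∈ D.support,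
      ∃ Hs : Fin G.N → Fin (d + 1) → ℝ,
        Function.IsFixedPt (θ.step G) Hs ∧
        (∀ H, Function.IsFixedPt (θ.step G) H → H = Hs) ∧
        ∀ Us, G.IsOptimal Us → stateNorm (Hs - embedState d Us) ≤ ε := by
  have hdet : ∀ G ∈ D.support, G.A.det ≠ 0 := fun G hG =>
    GraphProblem.det_ne_zero_of_existsUnique_isOptimal (huniq G hG)
  obtain ⟨M, hM, hbound⟩ := GraphProblem.exists_uniform_bound hcompact hdet
  have hM0 : 0 < M := by linarith
  set ε' := min (ε / 2) 1 with hε'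
  have hε'0 : 0 < ε' := lt_min (by linarith) one_pos
  set δ := ε' / (12 * M ^ 26) with hδ
  have hδ0 : 0 < δ := by positivity
  have hδε : 12 * M ^ 26 * δ ≤ ε' := by
    rw [hδ, mul_div_cancel₀ _ (by positivity)]
  obtain ⟨P, hPnet, hPa, hPu, hP⟩ := exists_approx_mul (R := 3 * M ^ 5) hδ0
  -- Chosen so that the residual coordinate has norm at most `ε / 2`.
  set c := ε / (2 * (M * (3 * M ^ 5))) with hc
  have hc0 : 0 < c := by positivity
  obtain ⟨θ, hθ⟩ := exists_GNNBlock_step_eq p (M ^ 3) (1 / (M ^ 4) ^ 2) c hPnet hPu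
  refine ⟨1, 2, θ, fun G hG => ?_⟩
  obtain ⟨hN, hA, hB, hinv⟩ := hbound G hG
  obtain ⟨u, hres, hbox, hfix, huni, hdist⟩ := exists_unique_fixedPoint_of_bounds hM hδ0
    (min_le_right _ _) hδε hPa hP hN hA hB hinv (hdet G hG)
  have cancel : ∀ x, c⁻¹ * (c * x) = x := fun x => inv_mul_cancel_left₀ hc0.ne' x
  refine ⟨fun i => ![u i, c * (approxMulVec P G.A u i - G.B i)], ?_, fun H hH => ?_,
    fun Us hUs => ?_⟩
  · funext i k
    fin_cases k
    · refine (hθ G _ i).1.trans (Eq.trans ?_ (hfix i))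
      simp only [Matrix.cons_val_zero, Matrix.cons_val_one, cancel]
      rfl
    · exact (hθ G _ i).2
  · have e0 : ∀ i, H i 0 = _ := fun i => (congrFun (congrFun hH i) 0).symm.trans (hθ G H i).1
    have e1 : ∀ i, H i 1 = _ := fun i => (congrFun (congrFun hH i) 1).symm.trans (hθ G H i).2
    -- The clip puts the first coordinate of any fixed point in the box; substituting the second
    -- coordinate turns its equation into the one that `u` alone solves there.
    have hu : (fun i => H i 0) = u := by
      refine huni _ (fun i => ?_) fun i => ?_
      · rw [e0]
        exact abs_clip_le (by positivity) _
      · refine Eq.trans ?_ (e0 i).symm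
        simp only [e1, cancel]
        rfl
    funext i k
    fin_cases k
    · exact congrFun hu i
    · refine (e1 i).trans ?_
      rw [hu]
      rfl
  · have hUs' : Us = G.A⁻¹.mulVec G.B := by
      refine (huniq G hG).unique hUs (GraphProblem.isOptimal_of_mulVec_eq ?_)
      rw [Matrix.mulVec_mulVec, Matrix.mul_nonsing_inv _ (isUnit_iff_ne_zero.2 (hdet G hG)),
        Matrix.one_mulVec]
    refine stateNorm_le hε.le ?_ ?_
    · rw [← hUs'] at hdist
      exact hdist.trans (min_le_left _ _)
    · refine (euclidNorm_le_of_abs_le hN (by positivity : 0 ≤ c * (3 * M ^ 5))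
        fun i => ?_).trans_eq (by rw [hc]; field_simp)
      have : ((fun i => ![u i, c * (approxMulVec P G.A u i - G.B i)]) - embedState 1 Us) i 1 =
          c * (approxMulVec P G.A u i - G.B i) := by
        simp [embedState]
      rw [this, abs_mul, abs_of_pos hc0]
      exact mul_le_mul_of_nonneg_left (hres i) hc0.le
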